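/- Let $d\ge 0$ and let $\alpha=(\alpha_1,\dots,\alpha_{d+1})\in\mathbb R^{d+1}$ be strictly increasing, i.e. $\alpha_1<\alpha_2<\dots<\alpha_{d+1}$. Put $U_d^\alpha=\{x\in\mathbb R^{d+1} : \sum_i x_i=\sum_i\alpha_i\}$, and let $$\mathrm{Perm}(\alpha)=\mathrm{ConvexHull}\{(\alpha_{\pi(1)},\dots,\alpha_{\pi(d+1)}) : \pi\in\mathfrak S_{d+1}\}\subseteq U_d^\alpha$$ be the usual permutohedron. For a complete binary tree $T$ (a plane rooted tree in which every internal vertex has exactly two children, Left and Right) with $t$ internal vertices, whose Left and Right subtrees at the root have $a$ and $b$ internal vertices, put $\mathrm{val}(\alpha,T)=\sum_{k=1}^{t}\alpha_k-\sum_{k=1}^{a}\alpha_k-\sum_{k=1}^{b}\alpha_k$. If $T$ has $d+1$ internal vertices, hence $d+2$ leaves $\ell_1,\dots,\ell_{d+2}$ from left to right, let $T_{(i)}$ be the subtree of $T$ rooted at the closest common ancestor of $\ell_i$ and $\ell_{i+1}$, and let $v^\alpha_T=(\mathrm{val}(\alpha,T_{(1)}),\dots,\mathrm{val}(\alpha,T_{(d+1)}))$.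 The Loday associahedron is $$\mathrm{LodAsso}(\alpha)=\mathrm{ConvexHull}\{v^\alpha_T : T \text{ a complete binary tree with } d+1 \text{ internal vertices}\}.$$ A finite system of inequalities $\langle a_i,x\rangle\le b_i$, $i\in I$, is a minimal inequality description of a polytope $P\subseteq U_d^\alpha$ if $P=\{x\in U_d^\alpha : \langle a_i,x\rangle\le b_i \text{ for all } i\in I\}$ and $i\mapsto\{x\in P : \langle a_i,x\rangle=b_i\}$ is a bijection from $I$ onto the set of facets of $P$ (nonempty faces of dimension $\dim P-1$). A polytope $Q$ is called an $\alpha$-removohedron if there are a minimal inequality description of $\mathrm{Perm}(\alpha)$, indexed by a set $I$, and a subset $J\subseteq I$ such that $$Q=\{x\in U_d^\alpha : \langle a_j,x\rangle\le b_j \text{ for all } j\in J\}.$$ Then $\mathrm{LodAsso}(\alpha)$ is an $\alpha$-removohedron; that is, it is defined in $U_d^\alpha$ by a subset of the facet inequalities of $\mathrm{Perm}(\alpha)$. -/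

import Mathlib

/-! Vectors of `ℝ ^ (d + 1)` are functions `Fin (d + 1) → ℝ`, the pairing is the dot product `⬝ᵥ`,
and indices start at `0`: the entry `α_{k+1}` of a sequence `(α_1, …, α_{d+1})` is `α k`.

Complete binary trees (plane rooted trees whose internal vertices all have exactly two children)
are the terms of `BinaryTree Unit`: `nil` is the tree whose only vertex is a leaf, and `node () l r`
has a root with Left subtree `l` and Right subtree `r`. The number of internal vertices is
`BinaryTree.numNodes`, the number of leaves is `BinaryTree.numLeaves`. -/

namespace LodayAssociahedron

open scoped Matrix

/-- The affine hyperplane `U_d^α` of vectors with the same coordinate sum as `α`. -/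
def affU {d : ℕ} (α : Fin (d + 1) → ℝ) : Set (Fin (d + 1) → ℝ) :=
  {x | ∑ i, x i = ∑ i, α i}

/-- The usual permutohedron: the convex hull of all `(α_{π(1)}, …, α_{π(d+1)})`. -/
def permutohedron {d : ℕ} (α : Fin (d + 1) → ℝ) : Set (Fin (d + 1) → ℝ) :=
  convexHull ℝ (Set.range fun π : Equiv.Perm (Fin (d + 1)) => fun i => α (π i))

/-- The subtree of `T` rooted at the closest common ancestor of the leaves number `i` and `j`,
the leaves being numbered `0, 1, 2, …` from left to right. -/
def subtreeAtClosestCommonAncestor : BinaryTree Unit → ℕ → ℕ → BinaryTree Unit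
  | .nil, _, _ => .nil
  | .node u l r, i, j =>
    if i < l.numLeaves ∧ j < l.numLeaves then
      subtreeAtClosestCommonAncestor l i j
    else if l.numLeaves ≤ i ∧ l.numLeaves ≤ j then
      subtreeAtClosestCommonAncestor r (i - l.numLeaves) (j - l.numLeaves)
    else
      .node u l r

/-- The internal vertex with label `i` is the closest common ancestor of the two consecutive leaves
number `i` and `i + 1`; this is the subtree `T_(i)` rooted at it. -/
def subtreeAtLabel (T : BinaryTree Unit) (i : ℕ) : BinaryTree Unit :=
  subtreeAtClosestCommonAncestor T i (i + 1)

/-- The sum of the first `t` entries of `α`. -/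
def prefixSum {d : ℕ} (α : Fin (d + 1) → ℝ) (t : ℕ) : ℝ :=
  ∑ k : Fin (d + 1) with k.val < t, α k

/-- `val(α, T)`, from the numbers of internal vertices of `T` and of its Left and Right subtree. -/
def treeVal {d : ℕ} (α : Fin (d + 1) → ℝ) (T : BinaryTree Unit) : ℝ :=
  prefixSum α T.numNodes - prefixSum α T.left.numNodes - prefixSum α T.right.numNodes

/-- The point `v^α_T`, whose coordinate number `i` is `val(α, T_(i))`. -/
def lodayVertex {d : ℕ} (α : Fin (d + 1) → ℝ) (T : BinaryTree Unit) : Fin (d + 1) → ℝ :=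
  fun i => treeVal α (subtreeAtLabel T i)

/-- The Loday associahedron: the convex hull of the points `v^α_T`, where `T` runs over the
complete binary trees with `d + 1` internal vertices. -/
def lodAsso {d : ℕ} (α : Fin (d + 1) → ℝ) : Set (Fin (d + 1) → ℝ) :=
  convexHull ℝ {v | ∃ T : BinaryTree Unit, T.numNodes = d + 1 ∧ v = lodayVertex α T}

/-- `F` is the face of `P` on which the linear functional `⟨w, ·⟩` is maximal, for some `w`. -/
def IsFace {n : ℕ} (P F : Set (Fin n → ℝ)) : Prop :=
  ∃ w : Fin n → ℝ, F = {x | x ∈ P ∧ ∀ y ∈ P, w ⬝ᵥ y ≤ w ⬝ᵥ x}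

/-- The dimension of the affine span, for a nonempty set. -/
noncomputable def dimension {n : ℕ} (P : Set (Fin n → ℝ)) : ℕ :=
  Module.finrank ℝ (affineSpan ℝ P).direction

/-- A facet is a nonempty face whose dimension is one less than that of `P`. -/
def IsFacet {n : ℕ} (P F : Set (Fin n → ℝ)) : Prop :=
  F.Nonempty ∧ IsFace P F ∧ dimension F + 1 = dimension P

/-- The part of `U` that is cut out by the inequalities `⟨a, x⟩ ≤ b`, for `(a, b)` in `I`. -/
def solutionSet {n : ℕ} (U : Set (Fin n → ℝ)) (I : Finset ((Fin n → ℝ) × ℝ)) :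
    Set (Fin n → ℝ) :=
  {x | x ∈ U ∧ ∀ q ∈ I, q.1 ⬝ᵥ x ≤ q.2}

/-- The finite system `I` of inequalities `⟨a, x⟩ ≤ b` is a minimal inequality description of `P`
in `U`: it defines `P`, every inequality is facet-defining (its equality case is a facet of `P`),
and every facet of `P` comes from exactly one inequality of the system. -/
def IsMinimalDescription {n : ℕ} (U P : Set (Fin n → ℝ)) (I : Finset ((Fin n → ℝ) × ℝ)) : Prop :=
  P = solutionSet U I ∧
    Set.BijOn (fun q : (Fin n → ℝ) × ℝ => {x | x ∈ P ∧ q.1 ⬝ᵥ x = q.2}) ↑I {F | IsFacet P F}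

/-- `Q` is an `α`-removohedron: a polytope in `U_d^α` that is defined by a subset `J` of a system
`I` of facet inequalities that defines the permutohedron of `α`. -/
def IsRemovohedron {d : ℕ} (α : Fin (d + 1) → ℝ) (Q : Set (Fin (d + 1) → ℝ)) : Prop :=
  Bornology.IsBounded Q ∧
    ∃ I J : Finset ((Fin (d + 1) → ℝ) × ℝ),
      IsMinimalDescription (affU α) (permutohedron α) I ∧ J ⊆ I ∧ Q = solutionSet (affU α) J

end LodayAssociahedron

/-! The permutohedron is cut out of `U_d^α` by the inequalities
`∑ i ∈ S, x i ≥ α_1 + ⋯ + α_{|S|}` of all index sets `S`, and its facets are the equality cases of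
the nonempty proper `S`. Abel summation along the order of the entries of a weight `w` writes the
gap between the value of `w` at a suitable vertex and at `x` as a combination of the slacks of `x`,
with the consecutive differences of the sorted weights as coefficients. This gives the inequality
description, and it also puts the face of a nonconstant `w` into the equality case of one `S`.

The Loday associahedron is cut out by the same inequalities for the intervals `S` alone. Its
vertices satisfy them because the prefix sums of an increasing sequence are convex. Conversely a
nonnegative weight is minimized, among all solutions of the interval inequalities, at the tree whose
root is the position of the least weight and whose subtrees are built recursively: subtracting the
least weight splits the problem into the two intervals beside the root. -/

namespace LodayAssociahedron

open scoped Matrix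
open Finset

section Polyhedra

theorem mem_convexHull_of_forall_exists_dotProduct_le {ι : Type*} [Fintype ι] {s : Set (ι → ℝ)}
    (hs : s.Finite) {x : ι → ℝ} (h : ∀ w : ι → ℝ, ∃ v ∈ s, w ⬝ᵥ x ≤ w ⬝ᵥ v) :
    x ∈ convexHull ℝ s := by
  classical
  rw [← iInter_halfSpaces_eq (convex_convexHull ℝ s) (hs.isClosed_convexHull ℝ), Set.mem_iInter]
  intro l
  obtain ⟨w, hw⟩ := (dotProductEquiv ℝ ι).surjective l.toLinearMap
  have hl (y : ι → ℝ) : w ⬝ᵥ y = l y := LinearMap.congr_fun hw y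
  obtain ⟨v, hv, hle⟩ := h w
  exact ⟨v, subset_convexHull ℝ s hv, by rwa [hl, hl] at hle⟩

theorem convex_solutionSet {n : ℕ} {U : Set (Fin n → ℝ)} (hU : Convex ℝ U)
    (I : Finset ((Fin n → ℝ) × ℝ)) : Convex ℝ (solutionSet U I) := by
  have hI : solutionSet U I = U ∩ ⋂ q ∈ I, {x | q.1 ⬝ᵥ x ≤ q.2} := by
    ext x
    simp only [solutionSet, Set.mem_ofPred_eq, Set.mem_inter_iff, Set.mem_iInter]
  rw [hI]
  exact hU.inter <| convex_iInter₂ fun q _ =>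
    convex_halfSpace_le ⟨dotProduct_add q.1, fun c x => dotProduct_smul c q.1 x⟩ q.2

theorem convex_affU {d : ℕ} (α : Fin (d + 1) → ℝ) : Convex ℝ (affU α) :=
  convex_hyperplane ⟨fun x y => by simp [sum_add_distrib], fun c x => by simp [mul_sum]⟩ _

theorem isFace_of_forall_dotProduct_le {n : ℕ} {P : Set (Fin n → ℝ)} {a : Fin n → ℝ} {b : ℝ}
    (h : ∀ y ∈ P, a ⬝ᵥ y ≤ b) (hne : {x | x ∈ P ∧ a ⬝ᵥ x = b}.Nonempty) :
    IsFace P {x | x ∈ P ∧ a ⬝ᵥ x = b} := by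
  obtain ⟨v, hvP, hv⟩ := hne
  refine ⟨a, Set.ext fun x => and_congr_right fun hx => ⟨fun hxb y hy => ?_, fun hmax => ?_⟩⟩
  · exact (h y hy).trans_eq hxb.symm
  · exact (h x hx).antisymm (hv.symm.trans_le (hmax v hvP))

/-- The functional that defines `F` is constant on `F`, hence on the span of `F`, hence on `G`. -/
theorem IsFace.eq_of_subset_of_dimension_le {n : ℕ} {P F G : Set (Fin n → ℝ)} (hF : IsFace P F)
    (hne : F.Nonempty) (hFG : F ⊆ G) (hGP : G ⊆ P) (hdim : dimension G ≤ dimension F) :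
    F = G := by
  obtain ⟨w, rfl⟩ := hF
  obtain ⟨x₀, hx₀⟩ := hne
  set F := {x | x ∈ P ∧ ∀ y ∈ P, w ⬝ᵥ y ≤ w ⬝ᵥ x}
  refine hFG.antisymm fun x hx => ⟨hGP hx, fun y hy => (hx₀.2 y hy).trans_eq ?_⟩
  have hspan : vectorSpan ℝ F = vectorSpan ℝ G := by
    rw [dimension, dimension, direction_affineSpan, direction_affineSpan] at hdim
    exact Submodule.eq_of_le_of_finrank_le (vectorSpan_mono ℝ hFG) hdim
  have hker : vectorSpan ℝ F ≤ LinearMap.ker (dotProductEquiv ℝ (Fin n) w) := by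
    rw [vectorSpan, Submodule.span_le]
    rintro _ ⟨y, hy, z, hz, rfl⟩
    change w ⬝ᵥ (y - z) = 0
    rw [dotProduct_sub, sub_eq_zero]
    exact (hz.2 y hy.1).antisymm (hy.2 z hz.1)
  have hx₀x : w ⬝ᵥ (x₀ - x) = 0 := hker (hspan ▸ vsub_mem_vectorSpan ℝ (hFG hx₀) hx)
  rwa [dotProduct_sub, sub_eq_zero] at hx₀x

end Polyhedra

section PrefixSum

/-- The set of the first `k` indices, whose `α`-sum is `prefixSum α k`. -/
def initialSegment (n k : ℕ) : Finset (Fin n) := {i | i.val < k}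

@[simp]
theorem mem_initialSegment {n k : ℕ} {i : Fin n} : i ∈ initialSegment n k ↔ i.val < k := by
  simp [initialSegment]

@[simp]
theorem card_initialSegment (n k : ℕ) : #(initialSegment n k) = min n k :=
  Fin.card_filter_val_lt

variable {d : ℕ} (α : Fin (d + 1) → ℝ)

theorem prefixSum_eq_sum (k : ℕ) : prefixSum α k = ∑ i ∈ initialSegment (d + 1) k, α i := rfl

@[simp]
theorem prefixSum_zero : prefixSum α 0 = 0 := by simp [prefixSum]

theorem prefixSum_top : prefixSum α (d + 1) = ∑ i, α i := by
  rw [prefixSum, filter_true_of_mem fun i _ => i.isLt]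

theorem prefixSum_succ {k : ℕ} (hk : k < d + 1) :
    prefixSum α (k + 1) = prefixSum α k + α ⟨k, hk⟩ := by
  have hinsert : initialSegment (d + 1) (k + 1) = insert ⟨k, hk⟩ (initialSegment (d + 1) k) := by
    ext i
    simp only [mem_initialSegment, mem_insert, Fin.ext_iff]
    omega
  rw [prefixSum_eq_sum, hinsert, sum_insert (by simp), add_comm, prefixSum_eq_sum]

variable {α}

theorem prefixSum_add_sub_le (hα : Monotone α) {a b : ℕ} (hab : a ≤ b) (c : ℕ)
    (hb : b + c ≤ d + 1) :
    prefixSum α (a + c) - prefixSum α a ≤ prefixSum α (b + c) - prefixSum α b := by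
  induction c with
  | zero => simp
  | succ c ih =>
    have hentry : α ⟨a + c, by omega⟩ ≤ α ⟨b + c, by omega⟩ := hα (Fin.mk_le_mk.2 (by omega))
    rw [← add_assoc, ← add_assoc, prefixSum_succ α (by omega), prefixSum_succ α (by omega)]
    linarith [ih (by omega)]

theorem prefixSum_sub_sub_le (hα : Monotone α) {a b a' b' : ℕ} (ha : a' ≤ a) (hb : b' ≤ b)
    (h : a + b + 1 ≤ d + 1) :
    prefixSum α (a' + b' + 1) - prefixSum α a' - prefixSum α b' ≤
      prefixSum α (a + b + 1) - prefixSum α a - prefixSum α b := by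
  have hleft := prefixSum_add_sub_le hα ha (b' + 1) (by omega)
  have hright := prefixSum_add_sub_le hα hb (a + 1) (by omega)
  rw [show b' + (a + 1) = a + (b' + 1) by ring, show b + (a + 1) = a + b + 1 by ring] at hright
  rw [← add_assoc] at hleft
  linarith

theorem exists_equiv_sdiff_lt {n : ℕ} (A : Finset (Fin n)) :
    ∃ e : ↥(initialSegment n #A \ A) ≃ ↥(A \ initialSegment n #A), ∀ i, i.val < (e i).val := by
  have hcard : #(initialSegment n #A) = #A := by simpa using card_le_univ A
  let e := equivOfCardEq (card_sdiff_comm hcard)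
  refine ⟨e, fun i => ?_⟩
  have hi := mem_initialSegment.1 (mem_sdiff.1 i.2).1
  have hei := mt mem_initialSegment.2 (mem_sdiff.1 (e i).2).2
  exact hi.trans_le (not_lt.1 hei)

theorem prefixSum_card_le_sum (hα : Monotone α) (A : Finset (Fin (d + 1))) :
    prefixSum α #A ≤ ∑ i ∈ A, α i := by
  obtain ⟨e, he⟩ := exists_equiv_sdiff_lt A
  rw [prefixSum_eq_sum, ← sum_sdiff_le_sum_sdiff, ← sum_coe_sort, ← sum_coe_sort (A \ _),
    ← e.sum_comp]
  exact sum_le_sum fun i _ => hα (he i).le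

theorem prefixSum_card_lt_sum (hα : StrictMono α) {A : Finset (Fin (d + 1))}
    (hA : ¬A ⊆ initialSegment (d + 1) #A) : prefixSum α #A < ∑ i ∈ A, α i := by
  obtain ⟨e, he⟩ := exists_equiv_sdiff_lt A
  rw [prefixSum_eq_sum, ← sum_sdiff_lt_sum_sdiff, ← sum_coe_sort, ← sum_coe_sort (A \ _),
    ← e.sum_comp]
  have : Nonempty ↥(A \ initialSegment (d + 1) #A) := (sdiff_nonempty.2 hA).to_subtype
  have : Nonempty ↥(initialSegment (d + 1) #A \ A) := e.nonempty
  exact sum_lt_sum_of_nonempty univ_nonempty fun i _ => hα (he i)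

theorem sum_initialSegment_castSucc {M : Type*} [AddCommMonoid M] {n k : ℕ} (hk : k ≤ n)
    (y : Fin (n + 1) → M) :
    ∑ i ∈ initialSegment (n + 1) k, y i = ∑ i ∈ initialSegment n k, y i.castSucc := by
  have hmap : initialSegment (n + 1) k = (initialSegment n k).map Fin.castSuccEmb := by
    ext i
    cases i using Fin.lastCases with
    | last => simp [hk, Fin.castSucc_ne_last]
    | cast j => simp
  simp [hmap]

theorem sum_univ_mul_by_parts {R : Type*} [CommRing R] {n : ℕ} (w y : Fin (n + 1) → R) :
    ∑ i, w i * y i = w (Fin.last n) * ∑ i, y i -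
      ∑ k : Fin n, (w k.succ - w k.castSucc) * ∑ i ∈ initialSegment (n + 1) (k + 1), y i := by
  induction n with
  | zero => simp
  | succ n ih =>
    have hsegment (k : Fin (n + 1)) : ∑ i ∈ initialSegment (n + 2) (k + 1), y i =
        ∑ i ∈ initialSegment (n + 1) (k + 1), y i.castSucc :=
      sum_initialSegment_castSucc (by omega) y
    have hlast : initialSegment (n + 1) (n + 1) = univ :=
      eq_univ_of_forall fun i => mem_initialSegment.2 i.isLt
    simp only [hsegment]
    rw [Fin.sum_univ_castSucc, ih, Fin.sum_univ_castSucc y,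
      Fin.sum_univ_castSucc fun k : Fin (n + 1) => (w k.succ - w k.castSucc) * _]
    simp only [Fin.val_last, Fin.val_castSucc, Fin.succ_last, Fin.succ_castSucc, hlast]
    ring

end PrefixSum

section LowBlock

/-- The set of the `k` positions at which the permutation `π` has its least values. The order of the
entries of a weight `w` is encoded by a permutation `π` for which `w ∘ π.symm` is monotone; its
blocks are then the sets of positions of the `k` least weights. -/
def lowBlock {n : ℕ} (π : Equiv.Perm (Fin n)) (k : ℕ) : Finset (Fin n) :=
  (initialSegment n k).map π.symm.toEmbedding

theorem mem_lowBlock {n k : ℕ} {π : Equiv.Perm (Fin n)} {i : Fin n} :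
    i ∈ lowBlock π k ↔ (π i).val < k := by simp [lowBlock, mem_map_equiv]

theorem card_lowBlock {n k : ℕ} (π : Equiv.Perm (Fin n)) (hk : k ≤ n) : #(lowBlock π k) = k := by
  simp [lowBlock, hk]

theorem sum_lowBlock {M : Type*} [AddCommMonoid M] {n : ℕ} (π : Equiv.Perm (Fin n)) (k : ℕ)
    (f : Fin n → M) :
    ∑ i ∈ lowBlock π k, f i = ∑ j ∈ initialSegment n k, f (π.symm j) := by
  simp [lowBlock]

theorem exists_lowBlock_card_eq {n : ℕ} (S : Finset (Fin n)) :
    ∃ π : Equiv.Perm (Fin n), lowBlock π #S = S := by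
  have hcard : #S = #(initialSegment n #S) := by simpa using card_le_univ S
  let e := equivOfCardEq hcard
  refine ⟨e.extendSubtype, ext fun i => mem_lowBlock.trans ?_⟩
  rw [← mem_initialSegment]
  exact ⟨fun h => by_contra fun hi => e.extendSubtype_not_mem i hi h, e.extendSubtype_mem i⟩

variable {d : ℕ} {α : Fin (d + 1) → ℝ}

theorem prefixSum_card_le_sum_comp (hα : Monotone α) (π : Equiv.Perm (Fin (d + 1)))
    (S : Finset (Fin (d + 1))) : prefixSum α #S ≤ ∑ i ∈ S, α (π i) := by
  simpa using prefixSum_card_le_sum hα (S.map π.toEmbedding)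

theorem sum_comp_eq_prefixSum_card_iff (hα : StrictMono α) (π : Equiv.Perm (Fin (d + 1)))
    (S : Finset (Fin (d + 1))) : ∑ i ∈ S, α (π i) = prefixSum α #S ↔ lowBlock π #S = S := by
  constructor
  · intro h
    have hmap : S.map π.toEmbedding ⊆ initialSegment (d + 1) #(S.map π.toEmbedding) := by
      by_contra hS
      simpa [h] using prefixSum_card_lt_sum hα hS
    have hS : S ⊆ lowBlock π #S := fun i hi => by
      simpa [mem_lowBlock] using hmap (mem_map_of_mem π.toEmbedding hi)
    exact (eq_of_subset_of_card_le hS (card_lowBlock π (by simpa using card_le_univ S)).le).symm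
  · intro h
    conv_lhs => rw [← h]
    simp [sum_lowBlock, prefixSum_eq_sum]

/-- Abel summation along the order of `π`. -/
theorem dotProduct_comp_sub_dotProduct (π : Equiv.Perm (Fin (d + 1))) (w : Fin (d + 1) → ℝ)
    {x : Fin (d + 1) → ℝ} (hx : x ∈ affU α) :
    w ⬝ᵥ (α ∘ π) - w ⬝ᵥ x = ∑ k : Fin d, (w (π.symm k.succ) - w (π.symm k.castSucc)) *
      (∑ i ∈ lowBlock π (k + 1), x i - prefixSum α (k + 1)) := by
  have htotal : ∑ j, (α j - x (π.symm j)) = 0 := by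
    rw [sum_sub_distrib, Equiv.sum_comp, sub_eq_zero]
    exact hx.symm
  calc w ⬝ᵥ (α ∘ π) - w ⬝ᵥ x = ∑ j, w (π.symm j) * (α j - x (π.symm j)) := by
        rw [← dotProduct_sub, dotProduct, ← Equiv.sum_comp π.symm]
        simp
    _ = _ := by
        rw [sum_univ_mul_by_parts (fun j => w (π.symm j)), htotal, mul_zero, zero_sub,
          ← sum_neg_distrib]
        refine sum_congr rfl fun k _ => ?_
        rw [sum_sub_distrib, sum_lowBlock, prefixSum_eq_sum]
        ring

end LowBlock

section SubsetInequalities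

variable {d : ℕ} {α : Fin (d + 1) → ℝ}

/-- The inequality `∑ i ∈ S, x i ≥ α_1 + ⋯ + α_{|S|}`, in the form `⟨a, x⟩ ≤ b`. -/
noncomputable def subsetIneq (α : Fin (d + 1) → ℝ) (S : Finset (Fin (d + 1))) :
    (Fin (d + 1) → ℝ) × ℝ :=
  (fun i => if i ∈ S then -1 else 0, -prefixSum α #S)

theorem subsetIneq_dotProduct (S : Finset (Fin (d + 1))) (x : Fin (d + 1) → ℝ) :
    (subsetIneq α S).1 ⬝ᵥ x = -∑ i ∈ S, x i := by
  simp [subsetIneq, dotProduct, sum_ite_mem]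

theorem subsetIneq_dotProduct_le_iff {S : Finset (Fin (d + 1))} {x : Fin (d + 1) → ℝ} :
    (subsetIneq α S).1 ⬝ᵥ x ≤ (subsetIneq α S).2 ↔ prefixSum α #S ≤ ∑ i ∈ S, x i := by
  rw [subsetIneq_dotProduct]
  exact neg_le_neg_iff

open Classical in
/-- The inequalities of the nonempty proper index sets that belong to the family `𝒮`. -/
noncomputable def subsetSystem (α : Fin (d + 1) → ℝ) (𝒮 : Set (Finset (Fin (d + 1)))) :
    Finset ((Fin (d + 1) → ℝ) × ℝ) :=
  ({S | S.Nonempty ∧ S ≠ univ ∧ S ∈ 𝒮} : Finset (Finset (Fin (d + 1)))).image (subsetIneq α)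

theorem mem_subsetSystem {𝒮 : Set (Finset (Fin (d + 1)))} {q : (Fin (d + 1) → ℝ) × ℝ} :
    q ∈ subsetSystem α 𝒮 ↔ ∃ S, (S.Nonempty ∧ S ≠ univ ∧ S ∈ 𝒮) ∧ subsetIneq α S = q := by
  simp [subsetSystem]

theorem subsetSystem_mono (α : Fin (d + 1) → ℝ) {𝒮 𝒯 : Set (Finset (Fin (d + 1)))} (h : 𝒮 ⊆ 𝒯) :
    subsetSystem α 𝒮 ⊆ subsetSystem α 𝒯 := fun q hq => by
  obtain ⟨S, ⟨hne, huniv, hS⟩, rfl⟩ := mem_subsetSystem.1 hq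
  exact mem_subsetSystem.2 ⟨S, ⟨hne, huniv, h hS⟩, rfl⟩

/-- The inequalities of `∅` and `univ` hold throughout `U_d^α`. -/
theorem mem_solutionSet_subsetSystem {𝒮 : Set (Finset (Fin (d + 1)))} {x : Fin (d + 1) → ℝ} :
    x ∈ solutionSet (affU α) (subsetSystem α 𝒮) ↔
      x ∈ affU α ∧ ∀ S ∈ 𝒮, prefixSum α #S ≤ ∑ i ∈ S, x i := by
  refine and_congr_right fun hU => ⟨fun h S hS => ?_, fun h q hq => ?_⟩
  · rcases S.eq_empty_or_nonempty with rfl | hne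
    · simp
    by_cases huniv : S = univ
    · rw [huniv, card_univ, Fintype.card_fin, prefixSum_top]
      exact (Eq.symm hU).le
    · exact subsetIneq_dotProduct_le_iff.1 (h _ (mem_subsetSystem.2 ⟨S, ⟨hne, huniv, hS⟩, rfl⟩))
  · obtain ⟨S, ⟨-, -, hS⟩, rfl⟩ := mem_subsetSystem.1 hq
    exact subsetIneq_dotProduct_le_iff.2 (h S hS)

end SubsetInequalities

section Permutohedron

variable {d : ℕ} {α : Fin (d + 1) → ℝ}

theorem comp_mem_permutohedron (α : Fin (d + 1) → ℝ) (π : Equiv.Perm (Fin (d + 1))) :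
    α ∘ π ∈ permutohedron α :=
  subset_convexHull ℝ _ ⟨π, rfl⟩

theorem mul_slack_nonneg {x : Fin (d + 1) → ℝ} (hx : ∀ S, prefixSum α #S ≤ ∑ i ∈ S, x i)
    {π : Equiv.Perm (Fin (d + 1))} {w : Fin (d + 1) → ℝ} (hw : Monotone (w ∘ π.symm)) (k : Fin d) :
    0 ≤ (w (π.symm k.succ) - w (π.symm k.castSucc)) *
      (∑ i ∈ lowBlock π (k + 1), x i - prefixSum α (k + 1)) := by
  refine mul_nonneg (sub_nonneg.2 (hw k.castSucc_lt_succ.le)) (sub_nonneg.2 ?_)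
  simpa only [card_lowBlock π (show k.val + 1 ≤ d + 1 by omega)] using hx (lowBlock π (k + 1))

theorem permutohedron_eq_solutionSet (hα : Monotone α) :
    permutohedron α = solutionSet (affU α) (subsetSystem α Set.univ) := by
  refine (convexHull_min ?_ (convex_solutionSet (convex_affU α) _)).antisymm fun x hx => ?_
  · rintro _ ⟨π, rfl⟩
    exact mem_solutionSet_subsetSystem.2
      ⟨Equiv.sum_comp π α, fun S _ => prefixSum_card_le_sum_comp hα π S⟩
  · obtain ⟨hU, hS⟩ := mem_solutionSet_subsetSystem.1 hx
    refine mem_convexHull_of_forall_exists_dotProduct_le (Set.finite_range _) fun w => ?_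
    refine ⟨_, ⟨(Tuple.sort w).symm, rfl⟩, sub_nonneg.1 ?_⟩
    refine (sum_nonneg fun k _ => ?_).trans_eq (dotProduct_comp_sub_dotProduct _ w hU).symm
    exact mul_slack_nonneg (fun S => hS S trivial) (Tuple.monotone_sort w) k

theorem mem_permutohedron_iff (hα : Monotone α) {x : Fin (d + 1) → ℝ} :
    x ∈ permutohedron α ↔ x ∈ affU α ∧ ∀ S, prefixSum α #S ≤ ∑ i ∈ S, x i := by
  simp only [permutohedron_eq_solutionSet hα, mem_solutionSet_subsetSystem, Set.mem_univ,
    true_implies]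

end Permutohedron

section Facets

variable {d : ℕ} {α : Fin (d + 1) → ℝ}

/-- The face of the permutohedron on which the coordinate sum over `S` is least. -/
def subsetFace (α : Fin (d + 1) → ℝ) (S : Finset (Fin (d + 1))) : Set (Fin (d + 1) → ℝ) :=
  {x | x ∈ permutohedron α ∧ (subsetIneq α S).1 ⬝ᵥ x = (subsetIneq α S).2}

theorem mem_subsetFace {S : Finset (Fin (d + 1))} {x : Fin (d + 1) → ℝ} :
    x ∈ subsetFace α S ↔ x ∈ permutohedron α ∧ ∑ i ∈ S, x i = prefixSum α #S := by
  refine and_congr_right fun _ => ?_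
  rw [subsetIneq_dotProduct]
  exact neg_inj

theorem comp_mem_subsetFace_iff (hα : StrictMono α) {π : Equiv.Perm (Fin (d + 1))}
    {S : Finset (Fin (d + 1))} : α ∘ π ∈ subsetFace α S ↔ lowBlock π #S = S := by
  rw [mem_subsetFace, ← sum_comp_eq_prefixSum_card_iff hα]
  exact and_iff_right (comp_mem_permutohedron α π)

theorem subsetFace_univ (hα : Monotone α) : subsetFace α univ = permutohedron α := by
  ext x
  refine mem_subsetFace.trans (and_iff_left_of_imp fun hx => ?_)
  rw [card_univ, Fintype.card_fin, prefixSum_top]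
  exact ((mem_permutohedron_iff hα).1 hx).1

/-- The sum of the coordinates in `S`, as a linear functional. -/
def sumOn {n : ℕ} (S : Finset (Fin n)) : (Fin n → ℝ) →ₗ[ℝ] ℝ :=
  ∑ i ∈ S, LinearMap.proj i

@[simp]
theorem sumOn_apply {n : ℕ} (S : Finset (Fin n)) (x : Fin n → ℝ) : sumOn S x = ∑ i ∈ S, x i := by
  simp [sumOn]

theorem sub_comp_swap {ι R : Type*} [DecidableEq ι] [Ring R] (f : ι → R) (i j : ι) :
    f - f ∘ Equiv.swap i j = (f i - f j) • (Pi.single i 1 - Pi.single j 1) := by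
  ext k
  rcases eq_or_ne k i with rfl | hi <;> rcases eq_or_ne k j with rfl | hj <;>
    simp_all [Equiv.swap_apply_of_ne_of_ne]

theorem sum_smul_mem_of_sub_mem {ι R M : Type*} [Ring R] [AddCommGroup M] [Module R M]
    {V : Submodule R M} {A : Finset ι} {c : ι → R} {e : ι → M} (hc : ∑ i ∈ A, c i = 0)
    (he : ∀ i ∈ A, ∀ j ∈ A, e i - e j ∈ V) : ∑ i ∈ A, c i • e i ∈ V := by
  rcases A.eq_empty_or_nonempty with rfl | ⟨j, hj⟩
  · simp
  have hsub : ∑ i ∈ A, c i • e i = ∑ i ∈ A, c i • (e i - e j) := by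
    simp only [smul_sub, sum_sub_distrib, ← sum_smul, hc, zero_smul, sub_zero]
  rw [hsub]
  exact V.sum_mem fun i hi => V.smul_mem _ (he i hi j hj)

/-- Exchanging the entries at `i` and `j` leads from a vertex of the face to another one. -/
theorem single_sub_single_mem_vectorSpan (hα : StrictMono α) {S : Finset (Fin (d + 1))}
    {i j : Fin (d + 1)} (hij : i ∈ S ↔ j ∈ S) :
    (Pi.single i 1 - Pi.single j 1 : Fin (d + 1) → ℝ) ∈ vectorSpan ℝ (subsetFace α S) := by
  rcases eq_or_ne i j with rfl | hne
  · simp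
  obtain ⟨π, hπ⟩ := exists_lowBlock_card_eq S
  have hmem (k : Fin (d + 1)) : (π k).val < #S ↔ k ∈ S := by rw [← mem_lowBlock, hπ]
  have hswap : lowBlock (π * Equiv.swap i j) #S = S := by
    ext k
    rw [mem_lowBlock, Equiv.Perm.mul_apply, hmem, Equiv.swap_apply_def]
    split_ifs with hki hkj
    · rw [hki, hij]
    · rw [hkj, hij]
    · rfl
  have hspan := vsub_mem_vectorSpan ℝ ((comp_mem_subsetFace_iff hα).2 hπ)
    ((comp_mem_subsetFace_iff hα).2 hswap)
  rw [Equiv.Perm.coe_mul, ← Function.comp_assoc, vsub_eq_sub, sub_comp_swap] at hspan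
  exact (Submodule.smul_mem_iff _
    (sub_ne_zero.2 (hα.injective.ne (π.injective.ne hne)))).1 hspan

theorem vectorSpan_subsetFace (hα : StrictMono α) (S : Finset (Fin (d + 1))) :
    vectorSpan ℝ (subsetFace α S) = LinearMap.ker (sumOn univ) ⊓ LinearMap.ker (sumOn S) := by
  apply le_antisymm
  · rw [vectorSpan, Submodule.span_le]
    rintro _ ⟨x, hx, y, hy, rfl⟩
    rw [mem_subsetFace, mem_permutohedron_iff hα.monotone] at hx hy
    constructor
    · simpa [sub_eq_zero] using hx.1.1.trans hy.1.1.symm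
    · simp [hx.2, hy.2]
  · rintro v ⟨hv, hvS⟩
    replace hv : ∑ i, v i = 0 := by simpa using hv
    replace hvS : ∑ i ∈ S, v i = 0 := by simpa using hvS
    have hvSc : ∑ i ∈ Sᶜ, v i = 0 := by simpa [← sum_add_sum_compl S v, hvS] using hv
    rw [pi_eq_sum_univ' v, ← sum_add_sum_compl S]
    refine Submodule.add_mem _ (sum_smul_mem_of_sub_mem hvS fun i hi j hj => ?_)
      (sum_smul_mem_of_sub_mem hvSc fun i hi j hj => ?_)
    · exact single_sub_single_mem_vectorSpan hα (iff_of_true hi hj)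
    · exact single_sub_single_mem_vectorSpan hα (iff_of_false (mem_compl.1 hi) (mem_compl.1 hj))

theorem dimension_subsetFace (hα : StrictMono α) {S : Finset (Fin (d + 1))} (hS : S.Nonempty)
    (huniv : S ≠ univ) : dimension (subsetFace α S) + 1 = dimension (permutohedron α) := by
  rw [← subsetFace_univ hα.monotone, dimension, dimension, direction_affineSpan,
    direction_affineSpan, vectorSpan_subsetFace hα, vectorSpan_subsetFace hα, inf_idem]
  set Z := LinearMap.ker (sumOn (univ : Finset (Fin (d + 1))))
  have hne : (sumOn S).comp Z.subtype ≠ 0 := fun hzero => by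
    obtain ⟨s, hs⟩ := hS
    obtain ⟨t, ht⟩ : ∃ t, t ∉ S := by simpa [eq_univ_iff_forall] using huniv
    have hst : (Pi.single s 1 - Pi.single t 1 : Fin (d + 1) → ℝ) ∈ Z := by simp [Z]
    simpa [sum_pi_single', hs, ht] using LinearMap.congr_fun hzero ⟨_, hst⟩
  have hrank := Module.Dual.finrank_ker_add_one_of_ne_zero hne
  rwa [LinearMap.ker_comp, ← Submodule.finrank_map_subtype_eq, Submodule.map_comap_subtype]
    at hrank

theorem isFacet_subsetFace (hα : StrictMono α) {S : Finset (Fin (d + 1))} (hS : S.Nonempty)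
    (huniv : S ≠ univ) : IsFacet (permutohedron α) (subsetFace α S) := by
  obtain ⟨π, hπ⟩ := exists_lowBlock_card_eq S
  have hne : (subsetFace α S).Nonempty := ⟨_, (comp_mem_subsetFace_iff hα).2 hπ⟩
  refine ⟨hne, isFace_of_forall_dotProduct_le (fun y hy => ?_) hne,
    dimension_subsetFace hα hS huniv⟩
  exact subsetIneq_dotProduct_le_iff.2 (((mem_permutohedron_iff hα.monotone).1 hy).2 S)

theorem eq_of_subsetFace_eq (hα : StrictMono α) {S T : Finset (Fin (d + 1))} (hS : S.Nonempty)
    (hT : T.Nonempty) (h : subsetFace α S = subsetFace α T) : S = T := by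
  wlog hcard : #T ≤ #S generalizing S T
  · exact (this hT hS h.symm (le_of_not_ge hcard)).symm
  obtain ⟨π, hπS⟩ := exists_lowBlock_card_eq S
  have hπT : lowBlock π #T = T :=
    (comp_mem_subsetFace_iff hα).1 (h ▸ (comp_mem_subsetFace_iff hα).2 hπS)
  have hTS : T ⊆ S := fun i hi => by
    rw [← hπT, mem_lowBlock] at hi
    exact hπS ▸ mem_lowBlock.2 (hi.trans_le hcard)
  obtain ⟨t, ht⟩ := hT
  refine Subset.antisymm (fun s hs => by_contra fun hsT => ?_) hTS
  have hspan := single_sub_single_mem_vectorSpan hα (iff_of_true (hTS ht) hs)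
  rw [h, vectorSpan_subsetFace hα] at hspan
  simpa [sum_pi_single', ht, hsT] using hspan.2

theorem exists_apply_castSucc_ne_apply_succ {β : Type*} {n : ℕ} {f : Fin (n + 1) → β}
    (hf : ∃ i j, f i ≠ f j) : ∃ k : Fin n, f k.castSucc ≠ f k.succ := by
  by_contra! h
  have hconst (i : Fin (n + 1)) : f i = f 0 := by
    induction i using Fin.induction with
    | zero => rfl
    | succ i ih => rw [← h, ih]
  obtain ⟨i, j, hij⟩ := hf
  exact hij ((hconst i).trans (hconst j).symm)

/-- All slacks with a nonzero coefficient in the slack identity vanish on the face of `w`. -/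
theorem exists_face_subset_subsetFace (hα : Monotone α) {w : Fin (d + 1) → ℝ}
    (hw : ∃ i j, w i ≠ w j) :
    ∃ S : Finset (Fin (d + 1)), S.Nonempty ∧ S ≠ univ ∧
      {x | x ∈ permutohedron α ∧ ∀ y ∈ permutohedron α, w ⬝ᵥ y ≤ w ⬝ᵥ x} ⊆ subsetFace α S := by
  set π := (Tuple.sort w).symm
  have hmono : Monotone (w ∘ π.symm) := Tuple.monotone_sort w
  obtain ⟨k, hk⟩ : ∃ k : Fin d, w (π.symm k.castSucc) ≠ w (π.symm k.succ) := by
    obtain ⟨i, j, hij⟩ := hw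
    exact exists_apply_castSucc_ne_apply_succ (f := w ∘ π.symm) ⟨π i, π j, by simpa using hij⟩
  have hcard : #(lowBlock π (k + 1)) = k + 1 := card_lowBlock π (by omega)
  refine ⟨lowBlock π (k + 1), card_pos.1 (by omega), fun huniv => ?_, fun x hx => ?_⟩
  · rw [huniv, card_univ, Fintype.card_fin] at hcard
    omega
  · obtain ⟨hxP, hmax⟩ := hx
    obtain ⟨hU, hS⟩ := (mem_permutohedron_iff hα).1 hxP
    have hslack := dotProduct_comp_sub_dotProduct π w hU
    have hterms := (sum_eq_zero_iff_of_nonneg fun k _ => mul_slack_nonneg hS hmono k).1 <|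
      (hslack.symm.trans_le (sub_nonpos.2 (hmax _ (comp_mem_permutohedron α π)))).antisymm
        (sum_nonneg fun k _ => mul_slack_nonneg hS hmono k)
    refine mem_subsetFace.2 ⟨hxP, ?_⟩
    rw [hcard]
    exact sub_eq_zero.1 <|
      (mul_eq_zero.1 (hterms k (mem_univ k))).resolve_left (sub_ne_zero.2 hk.symm)

theorem exists_subsetFace_eq_of_isFacet (hα : StrictMono α) {F : Set (Fin (d + 1) → ℝ)}
    (hF : IsFacet (permutohedron α) F) :
    ∃ S : Finset (Fin (d + 1)), S.Nonempty ∧ S ≠ univ ∧ subsetFace α S = F := by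
  obtain ⟨hne, hface, hdim⟩ := hF
  obtain ⟨w, hw⟩ := id hface
  by_cases hconst : ∃ i j, w i ≠ w j
  · obtain ⟨S, hS, huniv, hsub⟩ := exists_face_subset_subsetFace hα.monotone hconst
    rw [← hw] at hsub
    have hdimS := dimension_subsetFace hα hS huniv
    exact ⟨S, hS, huniv,
      (hface.eq_of_subset_of_dimension_le hne hsub (fun _ hx => hx.1) (by omega)).symm⟩
  · push Not at hconst
    have hval (y) (hy : y ∈ permutohedron α) : w ⬝ᵥ y = w 0 * ∑ i, α i := by
      rw [← show ∑ i, y i = ∑ i, α i from ((mem_permutohedron_iff hα.monotone).1 hy).1, mul_sum]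
      exact sum_congr rfl fun i _ => by rw [hconst i 0]
    have hFP : F = permutohedron α := by
      rw [hw]
      ext x
      exact and_iff_left_of_imp fun hx y hy => by rw [hval x hx, hval y hy]
    rw [hFP] at hdim
    omega

theorem isMinimalDescription_permutohedron (hα : StrictMono α) :
    IsMinimalDescription (affU α) (permutohedron α) (subsetSystem α Set.univ) := by
  refine ⟨permutohedron_eq_solutionSet hα.monotone, ?_, ?_, ?_⟩
  · intro q hq
    obtain ⟨S, ⟨hS, huniv, -⟩, rfl⟩ := mem_subsetSystem.1 hq
    exact isFacet_subsetFace hα hS huniv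
  · intro q hq q' hq' h
    obtain ⟨S, ⟨hS, -⟩, rfl⟩ := mem_subsetSystem.1 hq
    obtain ⟨T, ⟨hT, -⟩, rfl⟩ := mem_subsetSystem.1 hq'
    rw [eq_of_subsetFace_eq hα hS hT h]
  · intro F hF
    obtain ⟨S, hS, huniv, rfl⟩ := exists_subsetFace_eq_of_isFacet hα hF
    exact ⟨subsetIneq α S, mem_subsetSystem.2 ⟨S, ⟨hS, huniv, Set.mem_univ S⟩, rfl⟩, rfl⟩

end Facets

section TreeCoordinates

variable {d : ℕ} (α : Fin (d + 1) → ℝ)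

/-- The coordinate number `i` of `v^α_T`, for a tree with any number of internal vertices. -/
noncomputable def treeCoord (T : BinaryTree Unit) (i : ℕ) : ℝ :=
  treeVal α (subtreeAtLabel T i)

theorem treeVal_node (l r : BinaryTree Unit) :
    treeVal α (.node () l r) = prefixSum α (l.numNodes + r.numNodes + 1) -
      prefixSum α l.numNodes - prefixSum α r.numNodes := rfl

theorem treeCoord_left (l r : BinaryTree Unit) {i : ℕ} (hi : i < l.numNodes) :
    treeCoord α (.node () l r) i = treeCoord α l i := by
  have hleaves := l.numLeaves_eq_numNodes_succ
  rw [treeCoord, subtreeAtLabel, subtreeAtClosestCommonAncestor, if_pos (by omega)]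
  rfl

theorem treeCoord_root (l r : BinaryTree Unit) :
    treeCoord α (.node () l r) l.numNodes = treeVal α (.node () l r) := by
  have hleaves := l.numLeaves_eq_numNodes_succ
  rw [treeCoord, subtreeAtLabel, subtreeAtClosestCommonAncestor, if_neg (by omega),
    if_neg (by omega)]

theorem treeCoord_right (l r : BinaryTree Unit) (i : ℕ) :
    treeCoord α (.node () l r) (l.numNodes + 1 + i) = treeCoord α r i := by
  have hleaves := l.numLeaves_eq_numNodes_succ
  rw [treeCoord, subtreeAtLabel, subtreeAtClosestCommonAncestor, if_neg (by omega),
    if_pos (by omega), show l.numNodes + 1 + i - l.numLeaves = i by omega,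
    show l.numNodes + 1 + i + 1 - l.numLeaves = i + 1 by omega]
  rfl

theorem sum_range_mul_treeCoord_node (l r : BinaryTree Unit) {p k : ℕ} (hk : p + k = l.numNodes)
    (m : ℕ) (c : ℕ → ℝ) :
    ∑ i ∈ range (k + 1 + m), c i * treeCoord α (.node () l r) (p + i) =
      ∑ i ∈ range k, c i * treeCoord α l (p + i) + c k * treeVal α (.node () l r) +
        ∑ i ∈ range m, c (k + 1 + i) * treeCoord α r i := by
  rw [sum_range_add, sum_range_succ, hk, treeCoord_root]
  congr 2
  · exact sum_congr rfl fun i hi => by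
      rw [treeCoord_left α l r (by have := mem_range.1 hi; omega)]
  · funext i
    rw [← treeCoord_right α l r, ← hk, add_assoc, add_assoc, add_assoc]

theorem sum_range_treeCoord_node (l r : BinaryTree Unit) {p k : ℕ} (hk : p + k = l.numNodes)
    (m : ℕ) :
    ∑ i ∈ range (k + 1 + m), treeCoord α (.node () l r) (p + i) =
      ∑ i ∈ range k, treeCoord α l (p + i) + treeVal α (.node () l r) +
        ∑ i ∈ range m, treeCoord α r i := by
  simpa using sum_range_mul_treeCoord_node α l r hk m 1

theorem sum_range_treeCoord (T : BinaryTree Unit) :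
    ∑ i ∈ range T.numNodes, treeCoord α T i = prefixSum α T.numNodes := by
  induction T with
  | nil => simp
  | node u l r hl hr =>
    have hsplit := sum_range_treeCoord_node α l r (zero_add l.numNodes) r.numNodes
    simp only [zero_add, hl, hr] at hsplit
    rw [BinaryTree.numNodes, add_right_comm, hsplit, treeVal_node, add_right_comm l.numNodes]
    ring

variable {α}

theorem prefixSum_le_sum_treeCoord (hα : Monotone α) {T : BinaryTree Unit}
    (hT : T.numNodes ≤ d + 1) {p n : ℕ} (hn : p + n ≤ T.numNodes) :
    prefixSum α n ≤ ∑ i ∈ range n, treeCoord α T (p + i) := by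
  induction T generalizing p n with
  | nil =>
    obtain rfl : n = 0 := by simp only [BinaryTree.numNodes] at hn; omega
    simp
  | node u l r hl hr =>
    rw [BinaryTree.numNodes] at hT hn
    rcases le_or_gt (p + n) l.numNodes with hleft | hleft
    · refine (hl (by omega) hleft).trans_eq (sum_congr rfl fun i hi => ?_)
      rw [treeCoord_left α l r (by have := mem_range.1 hi; omega)]
    rcases le_or_gt p l.numNodes with hroot | hright
    · obtain ⟨k, hk⟩ := Nat.exists_eq_add_of_le hroot
      obtain ⟨m, rfl⟩ := Nat.exists_eq_add_of_le (show k + 1 ≤ n by omega)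
      have hval := prefixSum_sub_sub_le hα (show k ≤ l.numNodes by omega)
        (show m ≤ r.numNodes by omega) (by omega)
      have hsuml := hl (by omega) hk.ge
      have hsumr := hr (p := 0) (n := m) (by omega) (by omega)
      simp only [zero_add] at hsumr
      rw [sum_range_treeCoord_node α l r hk.symm, treeVal_node, add_right_comm]
      linarith
    · obtain ⟨q, rfl⟩ := Nat.exists_eq_add_of_le (Nat.succ_le_of_lt hright)
      refine (hr (p := q) (by omega) (by omega)).trans_eq (sum_congr rfl fun i _ => ?_)
      rw [← treeCoord_right α l r, ← add_assoc]

/-- Subtracting the weight of the root from all weights leaves the two subtrees and a multiple of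
the coordinate sum. -/
theorem sum_mul_treeCoord_node_le {l r : BinaryTree Unit} {u x : ℕ → ℝ} (hu : 0 ≤ u l.numNodes)
    (hl : ∑ i ∈ range l.numNodes, (u i - u l.numNodes) * treeCoord α l i ≤
      ∑ i ∈ range l.numNodes, (u i - u l.numNodes) * x i)
    (hr : ∑ i ∈ range r.numNodes, (u (l.numNodes + 1 + i) - u l.numNodes) * treeCoord α r i ≤
      ∑ i ∈ range r.numNodes, (u (l.numNodes + 1 + i) - u l.numNodes) * x (l.numNodes + 1 + i))
    (hx : prefixSum α (l.numNodes + 1 + r.numNodes) ≤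
      ∑ i ∈ range (l.numNodes + 1 + r.numNodes), x i) :
    ∑ i ∈ range (l.numNodes + 1 + r.numNodes), u i * treeCoord α (.node () l r) i ≤
      ∑ i ∈ range (l.numNodes + 1 + r.numNodes), u i * x i := by
  set a := l.numNodes with ha
  set t := a + 1 + r.numNodes with ht
  have hshift (y : ℕ → ℝ) : ∑ i ∈ range t, u i * y i =
      ∑ i ∈ range t, (u i - u a) * y i + u a * ∑ i ∈ range t, y i := by
    simp only [sub_mul, sum_sub_distrib, mul_sum, sub_add_cancel]
  have htotal : ∑ i ∈ range t, treeCoord α (.node () l r) i ≤ ∑ i ∈ range t, x i := by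
    have hnum : t = (BinaryTree.node () l r).numNodes := add_right_comm _ _ _
    rwa [hnum, sum_range_treeCoord, ← hnum]
  have hsplit := sum_range_mul_treeCoord_node α l r (zero_add _) r.numNodes fun i => u i - u a
  have hsplit_x := sum_range_add (fun i => (u i - u a) * x i) (a + 1) r.numNodes
  simp only [zero_add, ← ha, ← ht, sub_self, zero_mul, add_zero] at hsplit
  rw [sum_range_succ, sub_self, zero_mul, add_zero, ← ht] at hsplit_x
  rw [hshift, hshift, hsplit, hsplit_x]
  exact add_le_add (add_le_add hl hr) (mul_le_mul_of_nonneg_left htotal hu)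

/-- The minimizer is greedy: the root of each subtree sits at a position of least weight. -/
theorem exists_tree_sum_mul_treeCoord_le (α : Fin (d + 1) → ℝ) (t : ℕ) {u : ℕ → ℝ}
    (hu : ∀ i < t, 0 ≤ u i) :
    ∃ T : BinaryTree Unit, T.numNodes = t ∧ ∀ x : ℕ → ℝ,
      (∀ p n, p + n ≤ t → prefixSum α n ≤ ∑ i ∈ range n, x (p + i)) →
        ∑ i ∈ range t, u i * treeCoord α T i ≤ ∑ i ∈ range t, u i * x i := by
  induction t using Nat.strong_induction_on generalizing u with
  | _ t ih =>
    rcases Nat.eq_zero_or_pos t with rfl | ht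
    · exact ⟨.nil, rfl, by simp⟩
    obtain ⟨a, ha, hmin⟩ := exists_min_image (range t) u ⟨0, mem_range.2 ht⟩
    simp only [mem_range] at ha hmin
    obtain ⟨b, rfl⟩ := Nat.exists_eq_add_of_le (Nat.succ_le_of_lt ha)
    obtain ⟨l, rfl, hl⟩ := ih a ha (u := fun i => u i - u a)
      fun i hi => sub_nonneg.2 (hmin i (by omega))
    obtain ⟨r, rfl, hr⟩ := ih b (by omega) (u := fun i => u (l.numNodes + 1 + i) - u l.numNodes)
      fun i hi => sub_nonneg.2 (hmin _ (by omega))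
    refine ⟨.node () l r, add_right_comm _ _ _, fun x hx => ?_⟩
    refine sum_mul_treeCoord_node_le (hu _ ha) (hl x fun p n hn => hx p n (by omega))
      (hr (fun i => x (l.numNodes + 1 + i)) fun p n hn => ?_) ?_
    · simpa only [add_assoc] using hx (l.numNodes + 1 + p) n (by omega)
    · simpa using hx 0 (l.numNodes + 1 + r.numNodes) (by omega)

end TreeCoordinates

section LodAsso

variable {d : ℕ} {α : Fin (d + 1) → ℝ}

theorem sum_Icc_eq_sum_range {M : Type*} [AddCommMonoid M] {n : ℕ} (a b : Fin n) (g : ℕ → M) :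
    ∑ i ∈ Icc a b, g i = ∑ i ∈ range #(Icc a b), g (a + i) := by
  have hmap := sum_map (Icc a b) Fin.valEmbedding g
  rw [Fin.map_valEmbedding_Icc, ← Ico_add_one_right_eq_Icc, sum_Ico_eq_sum_range] at hmap
  rw [Fin.card_Icc, hmap]
  rfl

theorem finite_lodayVertices (α : Fin (d + 1) → ℝ) :
    {v | ∃ T : BinaryTree Unit, T.numNodes = d + 1 ∧ v = lodayVertex α T}.Finite := by
  refine ((BinaryTree.treesOfNumNodesEq (d + 1)).finite_toSet.image (lodayVertex α)).subset ?_
  rintro _ ⟨T, hT, rfl⟩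
  exact ⟨T, mem_coe.2 (BinaryTree.mem_treesOfNumNodesEq.2 hT), rfl⟩

theorem isBounded_lodAsso (α : Fin (d + 1) → ℝ) : Bornology.IsBounded (lodAsso α) :=
  ((finite_lodayVertices α).isCompact_convexHull ℝ).isBounded

theorem lodayVertex_mem_affU (α : Fin (d + 1) → ℝ) {T : BinaryTree Unit}
    (hT : T.numNodes = d + 1) : lodayVertex α T ∈ affU α := by
  have htotal := sum_range_treeCoord α T
  rwa [hT, prefixSum_top, ← Fin.sum_univ_eq_sum_range] at htotal

theorem exists_lodayVertex_dotProduct_le {x : Fin (d + 1) → ℝ} (hU : x ∈ affU α)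
    (hx : ∀ a b, prefixSum α #(Icc a b) ≤ ∑ i ∈ Icc a b, x i) (w : Fin (d + 1) → ℝ) :
    ∃ T : BinaryTree Unit, T.numNodes = d + 1 ∧ w ⬝ᵥ x ≤ w ⬝ᵥ lodayVertex α T := by
  obtain ⟨c, hc⟩ := (Set.finite_range w).bddAbove
  let extend (y : Fin (d + 1) → ℝ) (i : ℕ) : ℝ := y (Fin.ofNat (d + 1) i)
  have hextend (y : Fin (d + 1) → ℝ) (i : Fin (d + 1)) : extend y i = y i := by simp [extend]
  obtain ⟨T, hT, hmin⟩ := exists_tree_sum_mul_treeCoord_le α (d + 1) (u := fun i => c - extend w i)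
    fun i _ => sub_nonneg.2 (hc ⟨_, rfl⟩)
  refine ⟨T, hT, ?_⟩
  have hintervals (p n : ℕ) (hn : p + n ≤ d + 1) :
      prefixSum α n ≤ ∑ i ∈ range n, extend x (p + i) := by
    rcases n.eq_zero_or_pos with rfl | hpos
    · simp
    have hcard : #(Icc (⟨p, by omega⟩ : Fin (d + 1)) ⟨p + n - 1, by omega⟩) = n := by
      rw [Fin.card_Icc, Fin.val_mk, Fin.val_mk]
      omega
    have hI := hx ⟨p, by omega⟩ ⟨p + n - 1, by omega⟩
    simp only [← hextend x] at hI
    rwa [sum_Icc_eq_sum_range, hcard] at hI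
  have hle := hmin (extend x) hintervals
  rw [← Fin.sum_univ_eq_sum_range fun i => (c - extend w i) * treeCoord α T i,
    ← Fin.sum_univ_eq_sum_range fun i => (c - extend w i) * extend x i] at hle
  simp only [hextend, sub_mul, sum_sub_distrib, ← mul_sum] at hle
  have htotal : ∑ i, x i = ∑ i, lodayVertex α T i := hU.trans (lodayVertex_mem_affU α hT).symm
  rw [htotal] at hle
  exact (sub_le_sub_iff_left _).1 hle

theorem lodAsso_eq_solutionSet (hα : Monotone α) :
    lodAsso α = solutionSet (affU α) (subsetSystem α {S | ∃ a b, S = Icc a b}) := by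
  refine (convexHull_min ?_ (convex_solutionSet (convex_affU α) _)).antisymm fun x hx => ?_
  · rintro _ ⟨T, hT, rfl⟩
    refine mem_solutionSet_subsetSystem.2 ⟨lodayVertex_mem_affU α hT, ?_⟩
    rintro _ ⟨a, b, rfl⟩
    rw [show ∑ i ∈ Icc a b, lodayVertex α T i = ∑ i ∈ Icc a b, treeCoord α T i from rfl,
      sum_Icc_eq_sum_range]
    refine prefixSum_le_sum_treeCoord hα hT.le ?_
    rw [Fin.card_Icc, hT]
    omega
  · obtain ⟨hU, hS⟩ := mem_solutionSet_subsetSystem.1 hx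
    refine mem_convexHull_of_forall_exists_dotProduct_le (finite_lodayVertices α) fun w => ?_
    obtain ⟨T, hT, hle⟩ := exists_lodayVertex_dotProduct_le hU (fun a b => hS _ ⟨a, b, rfl⟩) w
    exact ⟨_, ⟨T, hT, rfl⟩, hle⟩

end LodAsso

end LodayAssociahedron

theorem corollary4p12 {d : ℕ} (α : Fin (d + 1) → ℝ) (hα : StrictMono α) :
    LodayAssociahedron.IsRemovohedron α (LodayAssociahedron.lodAsso α) := by
  open LodayAssociahedron in
  exact ⟨isBounded_lodAsso α, subsetSystem α Set.univ,
    subsetSystem α {S | ∃ a b, S = Finset.Icc a b}, isMinimalDescription_permutohedron hα,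
    subsetSystem_mono α (Set.subset_univ _), lodAsso_eq_solutionSet hα.monotone⟩
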